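/- Let $(B,g_B)$ and $(F,g_F)$ be connected smooth pseudo-Riemannian manifolds (without boundary) of dimensions $m\ge 3$ and $k\ge 1$ respectively, and let $\psi\in C^\infty(B)$ be positive. Put $\overline\mu=-\frac{k}{m-2}$ and $\overline\mu_\pm=\overline\mu\pm\sqrt{\overline\mu^2-\overline\mu}$, let $\mu\in\mathbb R\setminus\{0,1,\overline\mu,\overline\mu_+,\overline\mu_-\}$, and set $$\alpha^\Delta=\frac{1}{(m-2)\mu+k},\qquad \beta^\Delta=\frac{\mu}{(m-2)\mu+k},$$ $$\alpha^H=\frac{-[(m-2)\mu+k]}{\mu[(m-2)\mu+k]+k(\mu-1)},\qquad \beta^H=\frac{[(m-2)\mu+k]^2}{\mu[(m-2)\mu+k]+k(\mu-1)}.$$ Let the $(\psi,\mu)$-base conformal warped product be the product manifold $B\times F$ with the pseudo-Riemannian metric $g=\psi^{2\mu}g_B+\psi^2g_F$ (with $g_B$, $g_F$ pulled back along the projections). A pseudo-Riemannian manifold $(N,h)$ is called Einstein with constant $c\in\mathbb R$ if $\mathrm{Ric}_N=c\,h$. Write $\mathrm H_B^v=\nabla(\nabla v)$ for the Hessian and $\Delta_B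 v=\nabla^i\nabla_i v$ for the Laplace–Beltrami operator of $(B,g_B)$. Then for every $\lambda\in\mathbb R$: the $(\psi,\mu)$-base conformal warped product is Einstein with constant $\lambda$ if and only if there is $\nu\in\mathbb R$ such that $(F,g_F)$ is Einstein with constant $\nu$ and the following two equations hold on $B$: $$\lambda\psi^{2\mu}g_B=\mathrm{Ric}_B+\beta^H\,\psi^{-1/\alpha^H}\,\mathrm H_B^{\psi^{1/\alpha^H}}-\beta^\Delta\,\psi^{-1/\alpha^\Delta}\,\big(\Delta_B\psi^{1/\alpha^\Delta}\big)\,g_B,$$ $$\lambda\psi^{2}=\nu-\frac{1}{\psi^{2(\mu-1)}}\,\frac{\beta^\Delta}{\mu}\,\psi^{-1/\alpha^\Delta}\,\Delta_B\psi^{1/\alpha^\Delta}.$$ -/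

import Mathlib

set_option maxSynthPendingDepth 3

open scoped Manifold ContDiff

noncomputable section

namespace PseudoRiem

/-! ### Pseudo-Riemannian calculus in a coordinate domain

`G : E → E →L[ℝ] E →L[ℝ] ℝ` is a field of symmetric nondegenerate bilinear forms on (an open subset
of) the coordinate space `E`; everything is written without choosing a basis of `E`. -/

section Coordinates

variable {E : Type*} [NormedAddCommGroup E] [NormedSpace ℝ E]

/-- Christoffel symbols of the first kind:
`(u, v, w) ↦ (∂_u g(v, w) + ∂_v g(u, w) - ∂_w g(u, v)) / 2`. -/
def christoffelFirst (G : E → E →L[ℝ] E →L[ℝ] ℝ) (y : E) : E →L[ℝ] E →L[ℝ] E →L[ℝ] ℝ :=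
  let dG : E →L[ℝ] E →L[ℝ] E →L[ℝ] ℝ := fderiv ℝ G y
  let flipLast : (E →L[ℝ] E →L[ℝ] ℝ) →L[ℝ] E →L[ℝ] E →L[ℝ] ℝ :=
    (ContinuousLinearMap.flipₗᵢ ℝ E E ℝ).toContinuousLinearEquiv.toContinuousLinearMap
  (1 / 2 : ℝ) • (dG + dG.flip - flipLast.comp dG.flip)

theorem christoffelFirst_apply (G : E → E →L[ℝ] E →L[ℝ] ℝ) (y u v w : E) :
    christoffelFirst G y u v w =
      (1 / 2 : ℝ) * (fderiv ℝ G y u v w + fderiv ℝ G y v u w - fderiv ℝ G y w u v) := by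
  simp [christoffelFirst]

/-- Christoffel symbols of the Levi-Civita connection as an `E`-valued bilinear map
`(u, v) ↦ Γ(u, v)`: the index of `christoffelFirst` is raised with the inverse of the metric, so
that `∇_u V = ∂_u V + Γ(u, V)`. -/
def christoffel (G : E → E →L[ℝ] E →L[ℝ] ℝ) (y : E) : E →L[ℝ] E →L[ℝ] E :=
  (ContinuousLinearMap.compL ℝ E (E →L[ℝ] ℝ) E (G y).inverse).comp (christoffelFirst G y)

theorem christoffel_apply (G : E → E →L[ℝ] E →L[ℝ] ℝ) (y u v : E) :
    christoffel G y u v = (G y).inverse (christoffelFirst G y u v) := rfl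

/-- The curvature tensor `R(u, v) w = ∇_u ∇_v w - ∇_v ∇_u w` (for constant fields `u, v, w`). -/
def riemannLocal (G : E → E →L[ℝ] E →L[ℝ] ℝ) (y u v w : E) : E :=
  fderiv ℝ (christoffel G) y u v w - fderiv ℝ (christoffel G) y v u w
    + christoffel G y u (christoffel G y v w) - christoffel G y v (christoffel G y u w)

/-- The Ricci tensor `Ric(v, w) = trace (u ↦ R(u, v) w)`. -/
def ricciLocal (G : E → E →L[ℝ] E →L[ℝ] ℝ) (y v w : E) : ℝ :=
  LinearMap.trace ℝ E
    { toFun := fun u => riemannLocal G y u v w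
      map_add' := fun a b => by simp only [riemannLocal, map_add, add_apply]; abel
      map_smul' := fun r a => by
        simp only [riemannLocal, map_smul, smul_apply, RingHom.id_apply, smul_sub, smul_add] }

/-- The Hessian `H^f(u, v) = ∂_u ∂_v f - df(Γ(u, v))`. -/
def hessianLocal (G : E → E →L[ℝ] E →L[ℝ] ℝ) (f : E → ℝ) (y : E) : E →L[ℝ] E →L[ℝ] ℝ :=
  fderiv ℝ (fderiv ℝ f) y -
    (ContinuousLinearMap.compL ℝ E E ℝ (fderiv ℝ f y)).comp (christoffel G y)

theorem hessianLocal_apply (G : E → E →L[ℝ] E →L[ℝ] ℝ) (f : E → ℝ) (y u v : E) :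
    hessianLocal G f y u v = fderiv ℝ (fderiv ℝ f) y u v - fderiv ℝ f y (christoffel G y u v) :=
  rfl

/-- The Laplace-Beltrami operator: the metric trace of the Hessian. -/
def laplacianLocal (G : E → E →L[ℝ] E →L[ℝ] ℝ) (f : E → ℝ) (y : E) : ℝ :=
  LinearMap.trace ℝ E ((G y).inverse.comp (hessianLocal G f y) : E →L[ℝ] E).toLinearMap

end Coordinates

/-! ### Pseudo-Riemannian metrics on manifolds -/

section Manifold

variable {E : Type*} [NormedAddCommGroup E] [NormedSpace ℝ E]
  {H : Type*} [TopologicalSpace H] (I : ModelWithCorners ℝ E H)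
  {M : Type*} [TopologicalSpace M] [ChartedSpace H M]

/-- The coordinate expression in the chart at `p` of a field `b` of bilinear forms on the tangent
spaces of `M`, i.e. the pullback of `b` by the inverse `x` of the chart:
`y ↦ ((u, v) ↦ b_{x(y)} (dx_y u, dx_y v))`. -/
def inChart (b : ∀ q : M, TangentSpace I q →L[ℝ] TangentSpace I q →L[ℝ] ℝ) (p : M) (y : E) :
    E →L[ℝ] E →L[ℝ] ℝ :=
  ContinuousLinearMap.bilinearComp (E := E) (F := E) (E' := E) (F' := E)
    (b ((extChartAt I p).symm y))
    (mfderiv 𝓘(ℝ, E) I (extChartAt I p).symm y) (mfderiv 𝓘(ℝ, E) I (extChartAt I p).symm y)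

theorem inChart_apply (b : ∀ q : M, TangentSpace I q →L[ℝ] TangentSpace I q →L[ℝ] ℝ)
    (p : M) (y u v : E) :
    inChart I b p y u v = b ((extChartAt I p).symm y)
      (mfderiv 𝓘(ℝ, E) I (extChartAt I p).symm y u)
      (mfderiv 𝓘(ℝ, E) I (extChartAt I p).symm y v) := rfl

variable (M) in
/-- A smooth pseudo-Riemannian metric on the (boundaryless) manifold `M`: a smooth field of
symmetric nondegenerate bilinear forms on the tangent spaces. -/
structure Metric where
  /-- the bilinear form on the tangent space at a point -/
  val : ∀ q : M, TangentSpace I q →L[ℝ] TangentSpace I q →L[ℝ] ℝ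
  symm : ∀ (q : M) (u v : TangentSpace I q), val q u v = val q v u
  nondegenerate : ∀ (q : M) (u : TangentSpace I q), (∀ v, val q u v = 0) → u = 0
  smooth : ∀ p : M, ContDiffOn ℝ ∞ (inChart I val p) (extChartAt I p).target

namespace Metric

variable {I}

/-! The tensors at `p` are computed in the chart at `p`. This is the chart through which
`TangentSpace I p` is identified with `E` in Mathlib (see `inChart_self` below), so that the
coordinate expression is the value of the tensor on `TangentSpace I p`. -/

/-- The Ricci tensor. -/
def ricci (g : Metric I M) (p : M) (v w : TangentSpace I p) : ℝ :=
  ricciLocal (inChart I g.val p) (extChartAt I p p) v w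

/-- The Hessian of a function. -/
def hessian (g : Metric I M) (f : M → ℝ) (p : M) (v w : TangentSpace I p) : ℝ :=
  hessianLocal (inChart I g.val p) (f ∘ (extChartAt I p).symm) (extChartAt I p p) v w

/-- The Laplace-Beltrami operator. -/
def laplacian (g : Metric I M) (f : M → ℝ) (p : M) : ℝ :=
  laplacianLocal (inChart I g.val p) (f ∘ (extChartAt I p).symm) (extChartAt I p p)

/-- `(M, g)` is an Einstein manifold with constant `c`, i.e. `Ric = c g`. -/
def IsEinstein (g : Metric I M) (c : ℝ) : Prop :=
  ∀ (p : M) (v w : TangentSpace I p), g.ricci p v w = c * g.val p v w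

end Metric

theorem inChart_self [IsManifold I ∞ M] [I.Boundaryless]
    (b : ∀ q : M, TangentSpace I q →L[ℝ] TangentSpace I q →L[ℝ] ℝ) (p : M)
    (u v : TangentSpace I p) :
    inChart I b p (extChartAt I p p) u v = b p u v := by
  have h : mfderiv 𝓘(ℝ, E) I (extChartAt I p).symm (extChartAt I p p) =
      ContinuousLinearMap.id ℝ E := by
    have h1 := mfderivWithin_range_extChartAt_symm (I := I) (x := p)
    rwa [I.range_eq_univ, mfderivWithin_univ] at h1
  have h2 : (extChartAt I p).symm (extChartAt I p p) = p := extChartAt_to_inv p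
  have h3 : inChart I b p (extChartAt I p p) = (b p : E →L[ℝ] E →L[ℝ] ℝ) := by
    unfold inChart
    rw [h, h2]
    rfl
  exact congrArg (fun T : E →L[ℝ] E →L[ℝ] ℝ => T u v) h3

end Manifold

/-! ### Base conformal warped products -/

section Product

variable {E₁ : Type*} [NormedAddCommGroup E₁] [NormedSpace ℝ E₁]
  {H₁ : Type*} [TopologicalSpace H₁] {I₁ : ModelWithCorners ℝ E₁ H₁}
  {B : Type*} [TopologicalSpace B] [ChartedSpace H₁ B]
  {E₂ : Type*} [NormedAddCommGroup E₂] [NormedSpace ℝ E₂]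
  {H₂ : Type*} [TopologicalSpace H₂] {I₂ : ModelWithCorners ℝ E₂ H₂}
  {F : Type*} [TopologicalSpace F] [ChartedSpace H₂ F]

/-- The field of bilinear forms `c² g_B + w² g_F` (pulled back along the two projections) on
`B × F`. -/
def bcwpForm (gB : Metric I₁ B) (gF : Metric I₂ F) (c w : B → ℝ) (p : B × F) :
    TangentSpace (I₁.prod I₂) p →L[ℝ] TangentSpace (I₁.prod I₂) p →L[ℝ] ℝ :=
  (c p.1 ^ 2 • ContinuousLinearMap.bilinearComp (E := E₁) (F := E₁)
      (E' := E₁ × E₂) (F' := E₁ × E₂) (gB.val p.1)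
      (mfderiv (I₁.prod I₂) I₁ (Prod.fst : B × F → B) p)
      (mfderiv (I₁.prod I₂) I₁ (Prod.fst : B × F → B) p) +
    w p.1 ^ 2 • ContinuousLinearMap.bilinearComp (E := E₂) (F := E₂)
      (E' := E₁ × E₂) (F' := E₁ × E₂) (gF.val p.2)
      (mfderiv (I₁.prod I₂) I₂ (Prod.snd : B × F → F) p)
      (mfderiv (I₁.prod I₂) I₂ (Prod.snd : B × F → F) p) :
    (E₁ × E₂) →L[ℝ] (E₁ × E₂) →L[ℝ] ℝ)

theorem bcwpForm_apply (gB : Metric I₁ B) (gF : Metric I₂ F) (c w : B → ℝ) (p : B × F)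
    (u v : TangentSpace (I₁.prod I₂) p) :
    bcwpForm gB gF c w p u v =
      c p.1 ^ 2 * gB.val p.1 u.1 v.1 + w p.1 ^ 2 * gF.val p.2 u.2 v.2 := by
  unfold bcwpForm
  rw [mfderiv_fst, mfderiv_snd]
  rfl

theorem inChart_bcwpForm [IsManifold I₁ ∞ B] [IsManifold I₂ ∞ F] [I₁.Boundaryless]
    [I₂.Boundaryless] (gB : Metric I₁ B) (gF : Metric I₂ F) (c w : B → ℝ) (p : B × F)
    (y : E₁ × E₂) (hy : y ∈ (extChartAt (I₁.prod I₂) p).target) :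
    inChart (I₁.prod I₂) (bcwpForm gB gF c w) p y =
      c ((extChartAt I₁ p.1).symm y.1) ^ 2 • (inChart I₁ gB.val p.1 y.1).bilinearComp
        (ContinuousLinearMap.fst ℝ E₁ E₂) (ContinuousLinearMap.fst ℝ E₁ E₂) +
      w ((extChartAt I₁ p.1).symm y.1) ^ 2 • (inChart I₂ gF.val p.2 y.2).bilinearComp
        (ContinuousLinearMap.snd ℝ E₁ E₂) (ContinuousLinearMap.snd ℝ E₁ E₂) := by
  have hy' : y.1 ∈ (extChartAt I₁ p.1).target ∧ y.2 ∈ (extChartAt I₂ p.2).target := by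
    rw [extChartAt_prod] at hy
    exact hy
  have h1 : MDifferentiableAt 𝓘(ℝ, E₁) I₁ (extChartAt I₁ p.1).symm y.1 :=
    ((contMDiffOn_extChartAt_symm (n := ∞) p.1).contMDiffAt
      ((isOpen_extChartAt_target p.1).mem_nhds hy'.1)).mdifferentiableAt (by simp)
  have h2 : MDifferentiableAt 𝓘(ℝ, E₂) I₂ (extChartAt I₂ p.2).symm y.2 :=
    ((contMDiffOn_extChartAt_symm (n := ∞) p.2).contMDiffAt
      ((isOpen_extChartAt_target p.2).mem_nhds hy'.2)).mdifferentiableAt (by simp)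
  have hs : ((extChartAt (I₁.prod I₂) p).symm : E₁ × E₂ → B × F) =
      Prod.map (extChartAt I₁ p.1).symm (extChartAt I₂ p.2).symm := by
    rw [extChartAt_prod]
    rfl
  have key : mfderiv 𝓘(ℝ, E₁ × E₂) (I₁.prod I₂) (extChartAt (I₁.prod I₂) p).symm y =
      (mfderiv 𝓘(ℝ, E₁) I₁ (extChartAt I₁ p.1).symm y.1).prodMap
        (mfderiv 𝓘(ℝ, E₂) I₂ (extChartAt I₂ p.2).symm y.2) := by
    rw [modelWithCornersSelf_prod, hs, ← chartedSpaceSelf_prod]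
    exact mfderiv_prodMap h1 h2
  refine ContinuousLinearMap.ext fun u => ContinuousLinearMap.ext fun v => ?_
  rw [inChart_apply, bcwpForm_apply, key, hs]
  rfl

theorem contDiffOn_bilinearComp_self {X V W : Type*} [NormedAddCommGroup X] [NormedSpace ℝ X]
    [NormedAddCommGroup V] [NormedSpace ℝ V] [NormedAddCommGroup W] [NormedSpace ℝ W]
    {b : X → V →L[ℝ] V →L[ℝ] ℝ} {s : Set X} (hb : ContDiffOn ℝ ∞ b s) (π : W →L[ℝ] V) :
    ContDiffOn ℝ ∞ (fun x => (b x).bilinearComp π π) s := by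
  let P : (V →L[ℝ] V →L[ℝ] ℝ) →L[ℝ] W →L[ℝ] W →L[ℝ] ℝ :=
    ((ContinuousLinearMap.compL ℝ W V (W →L[ℝ] ℝ)).flip π).comp
      (ContinuousLinearMap.compL ℝ V (V →L[ℝ] ℝ) (W →L[ℝ] ℝ)
        ((ContinuousLinearMap.compL ℝ W V ℝ).flip π))
  exact P.contDiff.comp_contDiffOn hb

/-- The `[c, w]`-base conformal warped product `(B × F, c² g_B + w² g_F)` of two pseudo-Riemannian
manifolds, for smooth positive functions `c` and `w` on `B`. -/
def bcwp [IsManifold I₁ ∞ B] [IsManifold I₂ ∞ F] [I₁.Boundaryless] [I₂.Boundaryless]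
    (gB : Metric I₁ B) (gF : Metric I₂ F) (c w : B → ℝ)
    (hc : ContMDiff I₁ 𝓘(ℝ, ℝ) ∞ c) (hc0 : ∀ b, 0 < c b)
    (hw : ContMDiff I₁ 𝓘(ℝ, ℝ) ∞ w) (hw0 : ∀ b, 0 < w b) : Metric (I₁.prod I₂) (B × F) where
  val := bcwpForm gB gF c w
  symm p u v := by
    rw [bcwpForm_apply, bcwpForm_apply]
    exact congrArg₂ (fun a b : ℝ => c p.1 ^ 2 * a + w p.1 ^ 2 * b)
      (gB.symm p.1 u.1 v.1) (gF.symm p.2 u.2 v.2)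
  nondegenerate p u h := by
    have h1 : u.1 = 0 := gB.nondegenerate p.1 u.1 fun v => by
      have h3 := (bcwpForm_apply gB gF c w p u (v, (0 : E₂))).symm.trans (h (v, (0 : E₂)))
      have h0 : gF.val p.2 u.2 (0 : E₂) = 0 := map_zero (gF.val p.2 u.2)
      have h4 : c p.1 ^ 2 * gB.val p.1 u.1 v + w p.1 ^ 2 * gF.val p.2 u.2 (0 : E₂) = 0 := h3
      rw [h0, mul_zero, add_zero] at h4
      exact (mul_eq_zero.1 h4).resolve_left (pow_pos (hc0 _) 2).ne'
    have h2 : u.2 = 0 := gF.nondegenerate p.2 u.2 fun v => by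
      have h3 := (bcwpForm_apply gB gF c w p u ((0 : E₁), v)).symm.trans (h ((0 : E₁), v))
      have h0 : gB.val p.1 u.1 (0 : E₁) = 0 := map_zero (gB.val p.1 u.1)
      have h4 : c p.1 ^ 2 * gB.val p.1 u.1 (0 : E₁) + w p.1 ^ 2 * gF.val p.2 u.2 v = 0 := h3
      rw [h0, mul_zero, zero_add] at h4
      exact (mul_eq_zero.1 h4).resolve_left (pow_pos (hw0 _) 2).ne'
    exact Prod.ext h1 h2
  smooth p := by
    have hf : ∀ f : B → ℝ, ContMDiff I₁ 𝓘(ℝ, ℝ) ∞ f →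
        ContDiffOn ℝ ∞ (fun y : E₁ × E₂ => f ((extChartAt I₁ p.1).symm y.1) ^ 2)
          (extChartAt (I₁.prod I₂) p).target := fun f hf => by
      have h1 : ContDiffOn ℝ ∞ (f ∘ (extChartAt I₁ p.1).symm) (extChartAt I₁ p.1).target :=
        contMDiffOn_iff_contDiffOn.1 (hf.comp_contMDiffOn (contMDiffOn_extChartAt_symm p.1))
      exact (h1.comp contDiff_fst.contDiffOn fun y hy => by
        rw [extChartAt_prod] at hy
        exact hy.1).pow 2
    have hB : ContDiffOn ℝ ∞ (fun y : E₁ × E₂ => inChart I₁ gB.val p.1 y.1)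
        (extChartAt (I₁.prod I₂) p).target :=
      (gB.smooth p.1).comp contDiff_fst.contDiffOn fun y hy => by
        rw [extChartAt_prod] at hy
        exact hy.1
    have hF : ContDiffOn ℝ ∞ (fun y : E₁ × E₂ => inChart I₂ gF.val p.2 y.2)
        (extChartAt (I₁.prod I₂) p).target :=
      (gF.smooth p.2).comp contDiff_snd.contDiffOn fun y hy => by
        rw [extChartAt_prod] at hy
        exact hy.2
    refine ContDiffOn.congr ?_ fun y hy => inChart_bcwpForm gB gF c w p y hy
    exact ((hf c hc).smul (contDiffOn_bilinearComp_self hB (ContinuousLinearMap.fst ℝ E₁ E₂))).add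
      ((hf w hw).smul (contDiffOn_bilinearComp_self hF (ContinuousLinearMap.snd ℝ E₁ E₂)))

/-- The `(ψ, μ)`-base conformal warped product, i.e. the `[ψ^μ, ψ]`-base conformal warped
product `(B × F, ψ^(2μ) g_B + ψ² g_F)`. -/
def specialBcwp [IsManifold I₁ ∞ B] [IsManifold I₂ ∞ F] [I₁.Boundaryless] [I₂.Boundaryless]
    (gB : Metric I₁ B) (gF : Metric I₂ F) (ψ : B → ℝ) (μ : ℝ)
    (hψ : ContMDiff I₁ 𝓘(ℝ, ℝ) ∞ ψ) (hψ0 : ∀ b, 0 < ψ b) : Metric (I₁.prod I₂) (B × F) :=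
  bcwp gB gF (fun b => ψ b ^ μ) ψ
    (fun b => (Real.contDiffAt_rpow_const_of_ne (hψ0 b).ne').contMDiffAt.comp b (hψ b))
    (fun b => Real.rpow_pos_of_pos (hψ0 b) μ) hψ hψ0

end Product

/-! ### The numerical coefficients -/

/-- `α^Δ = 1 / ((m - 2) μ + k)`. -/
def alphaDelta (m k : ℕ) (μ : ℝ) : ℝ := 1 / (((m : ℝ) - 2) * μ + k)

/-- `β^Δ = μ / ((m - 2) μ + k)`. -/
def betaDelta (m k : ℕ) (μ : ℝ) : ℝ := μ / (((m : ℝ) - 2) * μ + k)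

/-- `α^H = -((m - 2) μ + k) / (μ ((m - 2) μ + k) + k (μ - 1))`. -/
def alphaHess (m k : ℕ) (μ : ℝ) : ℝ :=
  -(((m : ℝ) - 2) * μ + k) / (μ * (((m : ℝ) - 2) * μ + k) + k * (μ - 1))

/-- `β^H = ((m - 2) μ + k)² / (μ ((m - 2) μ + k) + k (μ - 1))`. -/
def betaHess (m k : ℕ) (μ : ℝ) : ℝ :=
  (((m : ℝ) - 2) * μ + k) ^ 2 / (μ * (((m : ℝ) - 2) * μ + k) + k * (μ - 1))

/-- The exceptional value `-k / (m - 2)`. -/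
def muBar (m k : ℕ) : ℝ := -(k : ℝ) / ((m : ℝ) - 2)

end PseudoRiem

end

namespace PseudoRiem

/-! ### Levi-Civita calculus of a metric on a coordinate domain -/

section Coordinates

variable {E : Type*} [NormedAddCommGroup E] [NormedSpace ℝ E]

/-! Write `ψ = e^f` and `D = (m - 2) μ + k`, `N = μ D + k (μ - 1)`. In a product chart the metric is
`e^(2μf) G₁ + e^(2f) G₂`. Guessing its Christoffel symbols, differentiating them and tracing the
curvature gives `ricciLocal_warpedLocal`: the Ricci tensor is `Ric₁ + Ric₂ - D Hess f + N df ⊗ df -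
(Δf + D |∇f|²) (μ G₁ + e^((2-2μ)f) G₂)`, with no mixed base-fibre term.

For any `a`, `e^(-af) Hess e^(af) = a Hess f + a² df ⊗ df`, and likewise for the Laplacian. The
exponents `1/α^H = -N/D` and `1/α^Δ = D` are those for which one such expression, weighted by `β^H`
or `β^Δ`, absorbs both first- and second-order terms in `f`. This is where `D ≠ 0` and `N ≠ 0`, i.e.
the excluded values of `μ`, enter (`ricci_specialBcwp`).

The Einstein equation then splits into a base block and a fibre block. The fibre block says that
`Ric_F` at `x` is `g_F` times a function of `b` alone. Since `g_F` is somewhere nonzero, that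
function is a constant `ν`. The converse is the sum of the two blocks. -/

theorem fderiv_bilin_apply {X V : Type*} [NormedAddCommGroup X] [NormedSpace ℝ X]
    [NormedAddCommGroup V] [NormedSpace ℝ V]
    {G : E → X →L[ℝ] X →L[ℝ] V} {y : E} (hG : DifferentiableAt ℝ G y) (v w : X) :
    HasFDerivAt (fun y' => G y' v w) (((fderiv ℝ G y).flip v).flip w) y := by
  have h1 : HasFDerivAt (fun y' => G y' v) ((fderiv ℝ G y).flip v) y := by
    simpa using hG.hasFDerivAt.clm_apply (hasFDerivAt_const v y)
  simpa using h1.clm_apply (hasFDerivAt_const w y)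

/-- Nondegeneracy is injectivity of `E → E*`, and the dimensions agree. Hence `inverse` in the
definitions really raises indices instead of taking its default value. -/
theorem isInvertible_of_nondegenerate [FiniteDimensional ℝ E] {b : E →L[ℝ] E →L[ℝ] ℝ}
    (hb : ∀ u, (∀ v, b u v = 0) → u = 0) : b.IsInvertible := by
  have hbinj : Function.Injective b.toLinearMap := by
    rw [injective_iff_map_eq_zero]
    exact fun u hu => hb u fun v => by
      have : b u = 0 := hu
      simp [this]
  have hdim : Module.finrank ℝ E = Module.finrank ℝ (E →L[ℝ] ℝ) := by
    rw [← (LinearMap.toContinuousLinearMap : (E →ₗ[ℝ] ℝ) ≃ₗ[ℝ] E →L[ℝ] ℝ).finrank_eq]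
    exact (Subspace.dual_finrank_eq (K := ℝ) (V := E)).symm
  have hfin : FiniteDimensional ℝ (E →L[ℝ] ℝ) :=
    (LinearMap.toContinuousLinearMap : (E →ₗ[ℝ] ℝ) ≃ₗ[ℝ] E →L[ℝ] ℝ).finiteDimensional
  let e := LinearEquiv.ofInjectiveOfFinrankEq b.toLinearMap hbinj hdim
  exact ⟨e.toContinuousLinearEquiv, ContinuousLinearMap.ext fun u => rfl⟩

/-- A smooth field of symmetric nondegenerate bilinear forms on an open set. -/
structure IsMetricOn (G : E → E →L[ℝ] E →L[ℝ] ℝ) (U : Set E) : Prop where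
  isOpen : IsOpen U
  contDiffOn : ContDiffOn ℝ ∞ G U
  symm : ∀ y ∈ U, ∀ u v, G y u v = G y v u
  nondegenerate : ∀ y ∈ U, ∀ u, (∀ v, G y u v = 0) → u = 0

/-- The gradient of a function. -/
noncomputable def gradLocal (G : E → E →L[ℝ] E →L[ℝ] ℝ) (f : E → ℝ) (y : E) : E :=
  (G y).inverse (fderiv ℝ f y)

/-- The Hessian with its second index raised, `u ↦ ∇_u (grad f)`. -/
noncomputable def hessianEnd (G : E → E →L[ℝ] E →L[ℝ] ℝ) (f : E → ℝ) (y : E) : E →L[ℝ] E :=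
  (G y).inverse.comp (hessianLocal G f y)

namespace IsMetricOn

variable {G : E → E →L[ℝ] E →L[ℝ] ℝ} {U : Set E} {y : E} {f : E → ℝ}

theorem contDiffAt (h : IsMetricOn G U) (hy : y ∈ U) : ContDiffAt ℝ ∞ G y :=
  h.contDiffOn.contDiffAt (h.isOpen.mem_nhds hy)

theorem differentiableAt (h : IsMetricOn G U) (hy : y ∈ U) : DifferentiableAt ℝ G y :=
  (h.contDiffAt hy).differentiableAt (by simp)

theorem fderiv_symm (h : IsMetricOn G U) (hy : y ∈ U) (u v w : E) :
    fderiv ℝ G y u v w = fderiv ℝ G y u w v := by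
  have h1 := fderiv_bilin_apply (h.differentiableAt hy) v w
  have h2 := fderiv_bilin_apply (h.differentiableAt hy) w v
  have h3 : (fun y' => G y' v w) =ᶠ[nhds y] fun y' => G y' w v := by
    filter_upwards [h.isOpen.mem_nhds hy] with z hz using h.symm z hz v w
  have h4 := h1.unique (h2.congr_of_eventuallyEq h3)
  simpa using congrArg (fun T => T u) h4

theorem christoffelFirst_symm (h : IsMetricOn G U) (hy : y ∈ U) (u v w : E) :
    christoffelFirst G y u v w = christoffelFirst G y v u w := by
  rw [christoffelFirst_apply, christoffelFirst_apply, h.fderiv_symm hy w u v]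
  ring

/-- Torsion-freeness of the connection, in coordinates. -/
theorem christoffel_symm (h : IsMetricOn G U) (hy : y ∈ U) (u v : E) :
    christoffel G y u v = christoffel G y v u := by
  rw [christoffel_apply, christoffel_apply]
  congr 1
  exact ContinuousLinearMap.ext fun w => h.christoffelFirst_symm hy u v w

theorem contDiffAt_christoffelFirst (h : IsMetricOn G U) (hy : y ∈ U) :
    ContDiffAt ℝ ∞ (christoffelFirst G) y := by
  have hd : ContDiffAt ℝ ∞ (fderiv ℝ G) y := (h.contDiffAt hy).fderiv_right (by simp)
  have hflip : ContDiffAt ℝ ∞ (fun y => (fderiv ℝ G y).flip) y :=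
    (ContinuousLinearMap.flipₗᵢ ℝ E E (E →L[ℝ] ℝ)).contDiff.contDiffAt.comp y hd
  exact ((hd.add hflip).sub (contDiffAt_const.clm_comp hflip)).const_smul (1 / 2 : ℝ)

theorem hessianLocal_symm (h : IsMetricOn G U) (hy : y ∈ U) (hf : ContDiffAt ℝ ∞ f y)
    (u v : E) : hessianLocal G f y u v = hessianLocal G f y v u := by
  rw [hessianLocal_apply, hessianLocal_apply, h.christoffel_symm hy u v]
  have : IsSymmSndFDerivAt ℝ f y := hf.isSymmSndFDerivAt (by
    simpa using WithTop.coe_le_coe.2 (le_top : (2 : ℕ∞) ≤ ⊤))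
  rw [this u v]

section Finite

variable [FiniteDimensional ℝ E]

theorem isInvertible (h : IsMetricOn G U) (hy : y ∈ U) : (G y).IsInvertible :=
  isInvertible_of_nondegenerate (h.nondegenerate y hy)

theorem contDiffAt_inverse (h : IsMetricOn G U) (hy : y ∈ U) :
    ContDiffAt ℝ ∞ (fun y => (G y).inverse) y := by
  have : CompleteSpace E := FiniteDimensional.complete ℝ E
  exact (h.isInvertible hy).contDiffAt_map_inverse.comp y (h.contDiffAt hy)

theorem contDiffAt_christoffel (h : IsMetricOn G U) (hy : y ∈ U) :
    ContDiffAt ℝ ∞ (christoffel G) y := by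
  have h1 : ContDiffAt ℝ ∞
      (fun y => ContinuousLinearMap.compL ℝ E (E →L[ℝ] ℝ) E (G y).inverse) y :=
    (ContinuousLinearMap.compL ℝ E (E →L[ℝ] ℝ) E).contDiff.contDiffAt.comp y
      (h.contDiffAt_inverse hy)
  exact h1.clm_comp (h.contDiffAt_christoffelFirst hy)

theorem apply_christoffel (h : IsMetricOn G U) (hy : y ∈ U) (u v w : E) :
    G y (christoffel G y u v) w = christoffelFirst G y u v w := by
  rw [christoffel_apply, (h.isInvertible hy).self_apply_inverse]

/-- The Levi-Civita connection is metric. -/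
theorem fderiv_eq (h : IsMetricOn G U) (hy : y ∈ U) (u v w : E) :
    fderiv ℝ G y u v w = G y (christoffel G y u v) w + G y v (christoffel G y u w) := by
  rw [h.symm y hy v, h.apply_christoffel hy, h.apply_christoffel hy, christoffelFirst_apply,
    christoffelFirst_apply, h.fderiv_symm hy u w v]
  ring

/-- The Koszul formula determines the connection, so a guessed formula for it only has to be tested
against all `w`. -/
theorem christoffel_eq (h : IsMetricOn G U) (hy : y ∈ U) {u v x : E}
    (hx : ∀ w, G y x w =
      1 / 2 * (fderiv ℝ G y u v w + fderiv ℝ G y v u w - fderiv ℝ G y w u v)) :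
    christoffel G y u v = x := by
  rw [christoffel_apply, (h.isInvertible hy).inverse_apply_eq]
  exact ContinuousLinearMap.ext fun w => by rw [christoffelFirst_apply, hx]

theorem apply_gradLocal (h : IsMetricOn G U) (hy : y ∈ U) (v : E) :
    G y (gradLocal G f y) v = fderiv ℝ f y v := by
  rw [gradLocal, (h.isInvertible hy).self_apply_inverse]

theorem apply_hessianEnd (h : IsMetricOn G U) (hy : y ∈ U) (u v : E) :
    G y (hessianEnd G f y u) v = hessianLocal G f y u v := by
  rw [hessianEnd, ContinuousLinearMap.comp_apply, (h.isInvertible hy).self_apply_inverse]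

theorem contDiffAt_gradLocal (h : IsMetricOn G U) (hy : y ∈ U) (hf : ContDiffAt ℝ ∞ f y) :
    ContDiffAt ℝ ∞ (gradLocal G f) y :=
  (h.contDiffAt_inverse hy).clm_apply (hf.fderiv_right (by simp))

/-- Differentiate `G(grad f, v) = df(v)` and use metric compatibility; nondegeneracy then removes
`v`. -/
theorem fderiv_gradLocal (h : IsMetricOn G U) (hy : y ∈ U) (hf : ContDiffAt ℝ ∞ f y) (u : E) :
    fderiv ℝ (gradLocal G f) y u =
      hessianEnd G f y u - christoffel G y u (gradLocal G f y) := by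
  have hT : DifferentiableAt ℝ (gradLocal G f) y :=
    (h.contDiffAt_gradLocal hy hf).differentiableAt (by simp)
  have hdf : DifferentiableAt ℝ (fderiv ℝ f) y :=
    (hf.fderiv_right (m := ∞) (by simp)).differentiableAt (by simp)
  have h1 := ((h.differentiableAt hy).hasFDerivAt.clm_apply hT.hasFDerivAt).congr_of_eventuallyEq
    (f₁ := fderiv ℝ f) (by
      filter_upwards [h.isOpen.mem_nhds hy] with z hz
      exact ContinuousLinearMap.ext fun v => (h.apply_gradLocal hz v).symm)
  have h2 := hdf.hasFDerivAt.unique h1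
  rw [← sub_eq_zero]
  refine h.nondegenerate y hy _ fun v => ?_
  have h3 := congrArg (fun S : E →L[ℝ] E →L[ℝ] ℝ => S u v) h2
  simp only [add_apply, ContinuousLinearMap.comp_apply, ContinuousLinearMap.flip_apply] at h3
  rw [h.fderiv_eq hy, h.apply_gradLocal hy] at h3
  simp only [map_sub, sub_apply, h.apply_hessianEnd hy, hessianLocal_apply]
  linarith

end Finite

end IsMetricOn

end Coordinates

/-! ### The connection of the warped metric -/

section Warped

variable {E₁ : Type*} [NormedAddCommGroup E₁] [NormedSpace ℝ E₁]
  {E₂ : Type*} [NormedAddCommGroup E₂] [NormedSpace ℝ E₂]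
  {G₁ : E₁ → E₁ →L[ℝ] E₁ →L[ℝ] ℝ} {G₂ : E₂ → E₂ →L[ℝ] E₂ →L[ℝ] ℝ} {f : E₁ → ℝ}
  {U₁ : Set E₁} {U₂ : Set E₂}

/-- The metric `e^(2 μ f) G₁ + e^(2 f) G₂` on a product of coordinate domains. -/
noncomputable def warpedLocal (G₁ : E₁ → E₁ →L[ℝ] E₁ →L[ℝ] ℝ) (G₂ : E₂ → E₂ →L[ℝ] E₂ →L[ℝ] ℝ)
    (f : E₁ → ℝ) (μ : ℝ) (y : E₁ × E₂) : (E₁ × E₂) →L[ℝ] (E₁ × E₂) →L[ℝ] ℝ :=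
  Real.exp (2 * μ * f y.1) • (G₁ y.1).bilinearComp
      (ContinuousLinearMap.fst ℝ E₁ E₂) (ContinuousLinearMap.fst ℝ E₁ E₂) +
    Real.exp (2 * f y.1) • (G₂ y.2).bilinearComp
      (ContinuousLinearMap.snd ℝ E₁ E₂) (ContinuousLinearMap.snd ℝ E₁ E₂)

theorem warpedLocal_apply (μ : ℝ) (y u v : E₁ × E₂) :
    warpedLocal G₁ G₂ f μ y u v = Real.exp (2 * μ * f y.1) * G₁ y.1 u.1 v.1 +
      Real.exp (2 * f y.1) * G₂ y.2 u.2 v.2 := rfl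

theorem isMetricOn_warpedLocal (h₁ : IsMetricOn G₁ U₁) (h₂ : IsMetricOn G₂ U₂)
    (hf : ContDiffOn ℝ ∞ f U₁) (μ : ℝ) : IsMetricOn (warpedLocal G₁ G₂ f μ) (U₁ ×ˢ U₂) where
  isOpen := h₁.isOpen.prod h₂.isOpen
  contDiffOn := by
    have hf' : ContDiffOn ℝ ∞ (fun y : E₁ × E₂ => f y.1) (U₁ ×ˢ U₂) :=
      hf.comp contDiff_fst.contDiffOn fun y hy => hy.1
    have h₁' : ContDiffOn ℝ ∞ (fun y : E₁ × E₂ => G₁ y.1) (U₁ ×ˢ U₂) :=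
      h₁.contDiffOn.comp contDiff_fst.contDiffOn fun y hy => hy.1
    have h₂' : ContDiffOn ℝ ∞ (fun y : E₁ × E₂ => G₂ y.2) (U₁ ×ˢ U₂) :=
      h₂.contDiffOn.comp contDiff_snd.contDiffOn fun y hy => hy.2
    exact ((contDiffOn_const.mul hf').exp.smul (contDiffOn_bilinearComp_self h₁' _)).add
      ((contDiffOn_const.mul hf').exp.smul (contDiffOn_bilinearComp_self h₂' _))
  symm y hy u v := by
    rw [warpedLocal_apply, warpedLocal_apply, h₁.symm _ hy.1, h₂.symm _ hy.2]
  nondegenerate y hy u h := by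
    refine Prod.ext (h₁.nondegenerate _ hy.1 _ fun v => ?_)
      (h₂.nondegenerate _ hy.2 _ fun v => ?_)
    · simpa [warpedLocal_apply, Real.exp_ne_zero] using h (v, 0)
    · simpa [warpedLocal_apply, Real.exp_ne_zero] using h (0, v)

theorem fderiv_warpedLocal (h₁ : IsMetricOn G₁ U₁) (h₂ : IsMetricOn G₂ U₂)
    (hf : ContDiffOn ℝ ∞ f U₁) (μ : ℝ) {y : E₁ × E₂} (hy : y ∈ U₁ ×ˢ U₂) (u v w : E₁ × E₂) :
    fderiv ℝ (warpedLocal G₁ G₂ f μ) y u v w =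
      Real.exp (2 * μ * f y.1) *
        (2 * μ * fderiv ℝ f y.1 u.1 * G₁ y.1 v.1 w.1 + fderiv ℝ G₁ y.1 u.1 v.1 w.1) +
      Real.exp (2 * f y.1) *
        (2 * fderiv ℝ f y.1 u.1 * G₂ y.2 v.2 w.2 + fderiv ℝ G₂ y.2 u.2 v.2 w.2) := by
  have hl := fderiv_bilin_apply
    ((isMetricOn_warpedLocal h₁ h₂ hf μ).differentiableAt hy) v w
  have hf1 : HasFDerivAt (fun y : E₁ × E₂ => f y.1)
      ((fderiv ℝ f y.1).comp (ContinuousLinearMap.fst ℝ E₁ E₂)) y :=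
    ((hf.contDiffAt (h₁.isOpen.mem_nhds hy.1)).differentiableAt
      (by simp)).hasFDerivAt.comp y hasFDerivAt_fst
  have hG1 := (fderiv_bilin_apply (h₁.differentiableAt hy.1) v.1 w.1).comp y
    (hasFDerivAt_fst (E := E₁) (F := E₂))
  have hG2 := (fderiv_bilin_apply (h₂.differentiableAt hy.2) v.2 w.2).comp y
    (hasFDerivAt_snd (E := E₁) (F := E₂))
  have hr := ((hf1.const_mul (2 * μ)).exp.mul hG1).add ((hf1.const_mul 2).exp.mul hG2)
  have h := congrArg (fun T => T u) (hl.unique hr)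
  simp at h
  rw [h]
  ring

/-- The Christoffel symbols of `e^(2 μ f) G₁ + e^(2 f) G₂`. -/
theorem christoffel_warpedLocal [FiniteDimensional ℝ E₁] [FiniteDimensional ℝ E₂]
    (h₁ : IsMetricOn G₁ U₁) (h₂ : IsMetricOn G₂ U₂)
    (hf : ContDiffOn ℝ ∞ f U₁) (μ : ℝ) {y : E₁ × E₂} (hy : y ∈ U₁ ×ˢ U₂) (u v : E₁ × E₂) :
    christoffel (warpedLocal G₁ G₂ f μ) y u v =
      (christoffel G₁ y.1 u.1 v.1 + (μ * fderiv ℝ f y.1 u.1) • v.1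
        + (μ * fderiv ℝ f y.1 v.1) • u.1
        - (μ * G₁ y.1 u.1 v.1 + Real.exp ((2 - 2 * μ) * f y.1) * G₂ y.2 u.2 v.2) •
          gradLocal G₁ f y.1,
      christoffel G₂ y.2 u.2 v.2 + fderiv ℝ f y.1 u.1 • v.2 + fderiv ℝ f y.1 v.1 • u.2) := by
  refine (isMetricOn_warpedLocal h₁ h₂ hf μ).christoffel_eq hy fun w => ?_
  -- Raising an index on the base multiplies by `e^(-2μf)`, which turns the fibre weight `e^(2f)`
  -- into `e^((2-2μ)f)`; the split makes both sides polynomial in the same two exponentials.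
  have he : Real.exp (2 * f y.1) =
      Real.exp (2 * μ * f y.1) * Real.exp ((2 - 2 * μ) * f y.1) := by
    rw [← Real.exp_add]
    congr 1
    ring
  simp only [fderiv_warpedLocal h₁ h₂ hf μ hy, warpedLocal_apply, map_add, map_sub, map_smul,
    add_apply, sub_apply, smul_apply, smul_eq_mul,
    h₁.apply_gradLocal hy.1, h₁.apply_christoffel hy.1, h₂.apply_christoffel hy.2,
    christoffelFirst_apply, he]
  ring

/-- The derivative of the Christoffel symbols of `e^(2 μ f) G₁ + e^(2 f) G₂`. -/
theorem fderiv_christoffel_warpedLocal [FiniteDimensional ℝ E₁] [FiniteDimensional ℝ E₂]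
    (h₁ : IsMetricOn G₁ U₁) (h₂ : IsMetricOn G₂ U₂)
    (hf : ContDiffOn ℝ ∞ f U₁) (μ : ℝ) {y : E₁ × E₂} (hy : y ∈ U₁ ×ˢ U₂) (u v w : E₁ × E₂) :
    fderiv ℝ (christoffel (warpedLocal G₁ G₂ f μ)) y u v w =
      (fderiv ℝ (christoffel G₁) y.1 u.1 v.1 w.1
        + (μ * fderiv ℝ (fderiv ℝ f) y.1 u.1 v.1) • w.1
        + (μ * fderiv ℝ (fderiv ℝ f) y.1 u.1 w.1) • v.1
        - (μ * fderiv ℝ G₁ y.1 u.1 v.1 w.1 + Real.exp ((2 - 2 * μ) * f y.1) *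
            ((2 - 2 * μ) * fderiv ℝ f y.1 u.1 * G₂ y.2 v.2 w.2 +
              fderiv ℝ G₂ y.2 u.2 v.2 w.2)) • gradLocal G₁ f y.1
        - (μ * G₁ y.1 v.1 w.1 + Real.exp ((2 - 2 * μ) * f y.1) * G₂ y.2 v.2 w.2) •
          fderiv ℝ (gradLocal G₁ f) y.1 u.1,
      fderiv ℝ (christoffel G₂) y.2 u.2 v.2 w.2
        + fderiv ℝ (fderiv ℝ f) y.1 u.1 v.1 • w.2
        + fderiv ℝ (fderiv ℝ f) y.1 u.1 w.1 • v.2) := by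
  have hG := isMetricOn_warpedLocal h₁ h₂ hf μ
  have hfy : ContDiffAt ℝ ∞ f y.1 := hf.contDiffAt (h₁.isOpen.mem_nhds hy.1)
  have hl := fderiv_bilin_apply ((hG.contDiffAt_christoffel hy).differentiableAt (by simp)) v w
  have hf1 : HasFDerivAt (fun y : E₁ × E₂ => f y.1)
      ((fderiv ℝ f y.1).comp (ContinuousLinearMap.fst ℝ E₁ E₂)) y :=
    (hfy.differentiableAt (by simp)).hasFDerivAt.comp y hasFDerivAt_fst
  have hdf : DifferentiableAt ℝ (fderiv ℝ f) y.1 :=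
    (hfy.fderiv_right (m := ∞) (by simp)).differentiableAt (by simp)
  have hdf1 : ∀ v : E₁, HasFDerivAt (fun y : E₁ × E₂ => fderiv ℝ f y.1 v)
      (((fderiv ℝ (fderiv ℝ f) y.1).flip v).comp (ContinuousLinearMap.fst ℝ E₁ E₂)) y := by
    intro v
    have : HasFDerivAt (fun y => fderiv ℝ f y v) ((fderiv ℝ (fderiv ℝ f) y.1).flip v) y.1 := by
      simpa using hdf.hasFDerivAt.clm_apply (hasFDerivAt_const v y.1)
    exact this.comp y hasFDerivAt_fst
  have hT : HasFDerivAt (fun y : E₁ × E₂ => gradLocal G₁ f y.1)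
      ((fderiv ℝ (gradLocal G₁ f) y.1).comp (ContinuousLinearMap.fst ℝ E₁ E₂)) y :=
    ((h₁.contDiffAt_gradLocal hy.1 hfy).differentiableAt (by simp)).hasFDerivAt.comp y
      hasFDerivAt_fst
  have hG1 := (fderiv_bilin_apply (h₁.differentiableAt hy.1) v.1 w.1).comp y
    (hasFDerivAt_fst (E := E₁) (F := E₂))
  have hG2 := (fderiv_bilin_apply (h₂.differentiableAt hy.2) v.2 w.2).comp y
    (hasFDerivAt_snd (E := E₁) (F := E₂))
  have hC1 := (fderiv_bilin_apply ((h₁.contDiffAt_christoffel hy.1).differentiableAt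
    (by simp)) v.1 w.1).comp y (hasFDerivAt_fst (E := E₁) (F := E₂))
  have hC2 := (fderiv_bilin_apply ((h₂.contDiffAt_christoffel hy.2).differentiableAt
    (by simp)) v.2 w.2).comp y (hasFDerivAt_snd (E := E₁) (F := E₂))
  have hr1 := ((hC1.add (((hdf1 v.1).const_mul μ).smul_const w.1)).add
    (((hdf1 w.1).const_mul μ).smul_const v.1)).sub
    (((hG1.const_mul μ).add ((hf1.const_mul (2 - 2 * μ)).exp.mul hG2)).smul hT)
  have hr2 := (hC2.add ((hdf1 v.1).smul_const w.2)).add ((hdf1 w.1).smul_const v.2)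
  -- The closed formula for the Christoffel symbols holds on the whole open product, so its
  -- derivative is theirs.
  have hr := (hr1.prodMk hr2).congr_of_eventuallyEq
    (f₁ := fun y => christoffel (warpedLocal G₁ G₂ f μ) y v w) (by
      filter_upwards [hG.isOpen.mem_nhds hy] with z hz
      exact christoffel_warpedLocal h₁ h₂ hf μ hz v w)
  have h := congrArg (fun T => T u) (hl.unique hr)
  simp only [ContinuousLinearMap.flip_apply] at h
  rw [h]
  refine Prod.ext ?_ ?_
  · simp
    module
  · simp

end Warped

/-! ### Curvature and Ricci tensor of the warped metric -/

section Warped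

variable {E₁ : Type*} [NormedAddCommGroup E₁] [NormedSpace ℝ E₁] [FiniteDimensional ℝ E₁]
  {E₂ : Type*} [NormedAddCommGroup E₂] [NormedSpace ℝ E₂] [FiniteDimensional ℝ E₂]
  {G₁ : E₁ → E₁ →L[ℝ] E₁ →L[ℝ] ℝ} {G₂ : E₂ → E₂ →L[ℝ] E₂ →L[ℝ] ℝ} {f : E₁ → ℝ}
  {U₁ : Set E₁} {U₂ : Set E₂}

/-- The trace needs only the diagonal blocks of `u ↦ R(u, v) w`; this is the base block. Once `∂∂f`,
`∂G₁` and `∂ grad f` are rewritten through the Hessian and the Christoffel symbols, the leftover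
Christoffel terms outside the base curvature cancel. -/
theorem riemannLocal_warpedLocal_fst
    (h₁ : IsMetricOn G₁ U₁) (h₂ : IsMetricOn G₂ U₂)
    (hf : ContDiffOn ℝ ∞ f U₁) (μ : ℝ) {y : E₁ × E₂} (hy : y ∈ U₁ ×ˢ U₂)
    (u : E₁) (v w : E₁ × E₂) {θ : E₁ → ℝ} (hθ : θ = fderiv ℝ f y.1)
    {T : E₁} (hT : T = gradLocal G₁ f y.1) {ρ : ℝ} (hρ : ρ = Real.exp ((2 - 2 * μ) * f y.1)) :
    (riemannLocal (warpedLocal G₁ G₂ f μ) y (u, 0) v w).1 =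
      riemannLocal G₁ y.1 u v.1 w.1
      + (-μ * hessianLocal G₁ f y.1 v.1 w.1 + μ ^ 2 * θ v.1 * θ w.1
          - μ * θ T * (μ * G₁ y.1 v.1 w.1 + ρ * G₂ y.2 v.2 w.2)) • u
      - (μ * G₁ y.1 v.1 w.1 + ρ * G₂ y.2 v.2 w.2) • hessianEnd G₁ f y.1 u
      + θ u • (((2 * μ - 1) * ρ * G₂ y.2 v.2 w.2 + μ ^ 2 * G₁ y.1 v.1 w.1) • T
          - (μ ^ 2 * θ w.1) • v.1)
      + (μ * hessianLocal G₁ f y.1 w.1 u) • v.1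
      + G₁ y.1 w.1 u • (μ • hessianEnd G₁ f y.1 v.1 + (μ ^ 2 * θ T) • v.1
          - (μ ^ 2 * θ v.1) • T) := by
  have hfy : ContDiffAt ℝ ∞ f y.1 := hf.contDiffAt (h₁.isOpen.mem_nhds hy.1)
  have hd : ∀ a b, fderiv ℝ (fderiv ℝ f) y.1 a b =
      hessianLocal G₁ f y.1 a b + fderiv ℝ f y.1 (christoffel G₁ y.1 a b) := fun a b => by
    rw [hessianLocal_apply]
    ring
  have hGT : ∀ a, G₁ y.1 a (gradLocal G₁ f y.1) = fderiv ℝ f y.1 a := fun a => by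
    rw [h₁.symm _ hy.1, h₁.apply_gradLocal hy.1]
  subst hθ hT hρ
  unfold riemannLocal
  simp only [fderiv_christoffel_warpedLocal h₁ h₂ hf μ hy, christoffel_warpedLocal h₁ h₂ hf μ hy,
    Prod.fst_add, Prod.fst_sub, map_add, map_sub, map_smul, map_zero, zero_apply,
    smul_eq_mul, hGT, hd, h₁.fderiv_eq hy.1, h₁.fderiv_gradLocal hy.1 hfy,
    h₁.christoffel_symm hy.1 v.1 u, h₁.hessianLocal_symm hy.1 hfy v.1 u,
    h₁.hessianLocal_symm hy.1 hfy w.1 u, h₁.symm _ hy.1 w.1 u, h₁.symm _ hy.1 v.1 u]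
  module

theorem riemannLocal_warpedLocal_snd
    (h₁ : IsMetricOn G₁ U₁) (h₂ : IsMetricOn G₂ U₂)
    (hf : ContDiffOn ℝ ∞ f U₁) (μ : ℝ) {y : E₁ × E₂} (hy : y ∈ U₁ ×ˢ U₂)
    (u : E₂) (v w : E₁ × E₂) {θ : E₁ → ℝ} (hθ : θ = fderiv ℝ f y.1)
    {T : E₁} (hT : T = gradLocal G₁ f y.1) {ρ : ℝ} (hρ : ρ = Real.exp ((2 - 2 * μ) * f y.1)) :
    (riemannLocal (warpedLocal G₁ G₂ f μ) y (0, u) v w).2 =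
      riemannLocal G₂ y.2 u v.2 w.2
      + (-hessianLocal G₁ f y.1 v.1 w.1 + (2 * μ - 1) * θ v.1 * θ w.1
          - θ T * (μ * G₁ y.1 v.1 w.1 + ρ * G₂ y.2 v.2 w.2)) • u
      + G₂ y.2 w.2 u • ((ρ * θ T) • v.2) := by
  have hd : ∀ a b, fderiv ℝ (fderiv ℝ f) y.1 a b =
      hessianLocal G₁ f y.1 a b + fderiv ℝ f y.1 (christoffel G₁ y.1 a b) := fun a b => by
    rw [hessianLocal_apply]
    ring
  subst hθ hT hρ
  unfold riemannLocal
  simp only [fderiv_christoffel_warpedLocal h₁ h₂ hf μ hy, christoffel_warpedLocal h₁ h₂ hf μ hy,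
    Prod.snd_add, Prod.snd_sub, map_add, map_sub, map_smul, map_zero, zero_apply,
    smul_eq_mul, hd, h₂.christoffel_symm hy.2 v.2 u, h₂.symm _ hy.2 w.2 u]
  module

/-- Cyclicity of the trace moves the projections to the right of `L`, where `inl ∘ fst + inr ∘ snd =
id`. -/
theorem trace_prod_eq (L : (E₁ × E₂) →ₗ[ℝ] (E₁ × E₂)) :
    LinearMap.trace ℝ (E₁ × E₂) L =
      LinearMap.trace ℝ E₁ (LinearMap.fst ℝ E₁ E₂ ∘ₗ L ∘ₗ LinearMap.inl ℝ E₁ E₂) +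
      LinearMap.trace ℝ E₂ (LinearMap.snd ℝ E₁ E₂ ∘ₗ L ∘ₗ LinearMap.inr ℝ E₁ E₂) := by
  rw [LinearMap.trace_comp_comm' (L ∘ₗ LinearMap.inl ℝ E₁ E₂) (LinearMap.fst ℝ E₁ E₂),
    LinearMap.trace_comp_comm' (L ∘ₗ LinearMap.inr ℝ E₁ E₂) (LinearMap.snd ℝ E₁ E₂), ← map_add]
  congr 1
  refine LinearMap.ext fun x => ?_
  simp [← map_add]

theorem trace_hessianEnd {E : Type*} [NormedAddCommGroup E] [NormedSpace ℝ E]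
    (G : E → E →L[ℝ] E →L[ℝ] ℝ) (f : E → ℝ) (y : E) :
    LinearMap.trace ℝ E (hessianEnd G f y).toLinearMap = laplacianLocal G f y := rfl

/-- The linear map whose trace is the Ricci tensor. -/
noncomputable def riemannEnd {E : Type*} [NormedAddCommGroup E] [NormedSpace ℝ E]
    (G : E → E →L[ℝ] E →L[ℝ] ℝ) (y v w : E) : E →ₗ[ℝ] E where
  toFun u := riemannLocal G y u v w
  map_add' a b := by simp only [riemannLocal, map_add, add_apply]; abel
  map_smul' r a := by
    simp only [riemannLocal, map_smul, smul_apply, RingHom.id_apply, smul_sub, smul_add]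

theorem trace_riemannEnd {E : Type*} [NormedAddCommGroup E] [NormedSpace ℝ E]
    (G : E → E →L[ℝ] E →L[ℝ] ℝ) (y v w : E) :
    LinearMap.trace ℝ E (riemannEnd G y v w) = ricciLocal G y v w := rfl

/-- The Ricci tensor of `e^(2 μ f) G₁ + e^(2 f) G₂`. -/
theorem ricciLocal_warpedLocal
    (h₁ : IsMetricOn G₁ U₁) (h₂ : IsMetricOn G₂ U₂)
    (hf : ContDiffOn ℝ ∞ f U₁) (μ : ℝ) {y : E₁ × E₂} (hy : y ∈ U₁ ×ˢ U₂) (v w : E₁ × E₂)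
    {m k : ℝ} (hm : (Module.finrank ℝ E₁ : ℝ) = m) (hk : (Module.finrank ℝ E₂ : ℝ) = k) :
    ricciLocal (warpedLocal G₁ G₂ f μ) y v w =
      ricciLocal G₁ y.1 v.1 w.1 + ricciLocal G₂ y.2 v.2 w.2
      - ((m - 2) * μ + k) * hessianLocal G₁ f y.1 v.1 w.1
      + (μ * ((m - 2) * μ + k) + k * (μ - 1)) * (fderiv ℝ f y.1 v.1 * fderiv ℝ f y.1 w.1)
      - (laplacianLocal G₁ f y.1 + ((m - 2) * μ + k) * fderiv ℝ f y.1 (gradLocal G₁ f y.1)) *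
        (μ * G₁ y.1 v.1 w.1 + Real.exp ((2 - 2 * μ) * f y.1) * G₂ y.2 v.2 w.2) := by
  have hfy : ContDiffAt ℝ ∞ f y.1 := hf.contDiffAt (h₁.isOpen.mem_nhds hy.1)
  obtain ⟨T, hT⟩ : ∃ T, T = gradLocal G₁ f y.1 := ⟨_, rfl⟩
  obtain ⟨ρ, hρ⟩ : ∃ ρ, ρ = Real.exp ((2 - 2 * μ) * f y.1) := ⟨_, rfl⟩
  -- Each block is a curvature map plus multiples of the identity, multiples of the Hessian
  -- endomorphism, and rank-one maps. Their traces are the Ricci tensor, the dimension, the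
  -- Laplacian, and evaluations of covectors.
  have e1 : LinearMap.fst ℝ E₁ E₂ ∘ₗ riemannEnd (warpedLocal G₁ G₂ f μ) y v w ∘ₗ
      LinearMap.inl ℝ E₁ E₂ = riemannEnd G₁ y.1 v.1 w.1
      + (-μ * hessianLocal G₁ f y.1 v.1 w.1 + μ ^ 2 * fderiv ℝ f y.1 v.1 * fderiv ℝ f y.1 w.1
          - μ * fderiv ℝ f y.1 T * (μ * G₁ y.1 v.1 w.1 + ρ * G₂ y.2 v.2 w.2)) • LinearMap.id
      - (μ * G₁ y.1 v.1 w.1 + ρ * G₂ y.2 v.2 w.2) • (hessianEnd G₁ f y.1).toLinearMap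
      + (fderiv ℝ f y.1).toLinearMap.smulRight
          (((2 * μ - 1) * ρ * G₂ y.2 v.2 w.2 + μ ^ 2 * G₁ y.1 v.1 w.1) • T
          - (μ ^ 2 * fderiv ℝ f y.1 w.1) • v.1)
      + μ • (hessianLocal G₁ f y.1 w.1).toLinearMap.smulRight v.1
      + (G₁ y.1 w.1).toLinearMap.smulRight (μ • hessianEnd G₁ f y.1 v.1
          + (μ ^ 2 * fderiv ℝ f y.1 T) • v.1 - (μ ^ 2 * fderiv ℝ f y.1 v.1) • T) := by
    refine LinearMap.ext fun u => ?_
    refine (riemannLocal_warpedLocal_fst h₁ h₂ hf μ hy u v w rfl hT hρ).trans ?_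
    simp [riemannEnd, mul_smul]
  have e2 : LinearMap.snd ℝ E₁ E₂ ∘ₗ riemannEnd (warpedLocal G₁ G₂ f μ) y v w ∘ₗ
      LinearMap.inr ℝ E₁ E₂ = riemannEnd G₂ y.2 v.2 w.2
      + (-hessianLocal G₁ f y.1 v.1 w.1 + (2 * μ - 1) * fderiv ℝ f y.1 v.1 * fderiv ℝ f y.1 w.1
          - fderiv ℝ f y.1 T * (μ * G₁ y.1 v.1 w.1 + ρ * G₂ y.2 v.2 w.2)) • LinearMap.id
      + (G₂ y.2 w.2).toLinearMap.smulRight ((ρ * fderiv ℝ f y.1 T) • v.2) := by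
    refine LinearMap.ext fun u => ?_
    exact riemannLocal_warpedLocal_snd h₁ h₂ hf μ hy u v w rfl hT hρ
  have hGT : ∀ a, G₁ y.1 a T = fderiv ℝ f y.1 a := fun a => by
    rw [h₁.symm _ hy.1, hT, h₁.apply_gradLocal hy.1]
  have hGN : G₁ y.1 w.1 (hessianEnd G₁ f y.1 v.1) = hessianLocal G₁ f y.1 v.1 w.1 := by
    rw [h₁.symm _ hy.1, h₁.apply_hessianEnd hy.1]
  rw [← trace_riemannEnd, trace_prod_eq, e1, e2, ← hT, ← hρ]
  simp only [map_add, map_sub, map_smul, LinearMap.trace_smulRight, LinearMap.trace_id,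
    trace_riemannEnd, trace_hessianEnd, smul_eq_mul, hm, hk, ContinuousLinearMap.coe_coe,
    hGT, hGN, h₁.symm _ hy.1 w.1 v.1, h₂.symm _ hy.2 w.2 v.2,
    h₁.hessianLocal_symm hy.1 hfy w.1 v.1]
  ring

end Warped

/-! ### Hessian and Laplacian of powers of `ψ` -/

section Power

variable {E : Type*} [NormedAddCommGroup E] [NormedSpace ℝ E]
  {G : E → E →L[ℝ] E →L[ℝ] ℝ} {f : E → ℝ} {y : E}

/-- The Hessian of `e^(a f)`. -/
theorem hessianLocal_exp (hf : ContDiffAt ℝ ∞ f y) (a : ℝ) :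
    hessianLocal G (fun x => Real.exp (a * f x)) y =
      Real.exp (a * f y) • (a • hessianLocal G f y +
        a ^ 2 • (fderiv ℝ f y).smulRight (fderiv ℝ f y)) := by
  have hdf : DifferentiableAt ℝ (fderiv ℝ f) y :=
    (hf.fderiv_right (m := ∞) (by simp)).differentiableAt (by simp)
  have h1 : ∀ x, DifferentiableAt ℝ f x → HasFDerivAt (fun x => Real.exp (a * f x))
      (Real.exp (a * f x) • a • fderiv ℝ f x) x := fun x hx =>
    (hx.hasFDerivAt.const_mul a).exp
  -- Smoothness at `y` gives differentiability nearby, so the first-derivative formula may be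
  -- differentiated again.
  have hev : ∀ᶠ x in nhds y, DifferentiableAt ℝ f x := by
    filter_upwards [(hf.of_le (m := 1) (by simp)).eventually (by simp)] with x hx
    exact hx.differentiableAt (by simp)
  have h2 : fderiv ℝ (fun x => Real.exp (a * f x)) =ᶠ[nhds y]
      fun x => Real.exp (a * f x) • a • fderiv ℝ f x := by
    filter_upwards [hev] with x hx using (h1 x hx).fderiv
  have h3 := ((h1 y hev.self_of_nhds).smul (hdf.hasFDerivAt.const_smul a)).congr_of_eventuallyEq h2
  ext u v
  rw [hessianLocal_apply, h3.fderiv, (h1 y hev.self_of_nhds).fderiv]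
  simp [hessianLocal_apply]
  ring

/-- The Laplacian of `e^(a f)`. -/
theorem laplacianLocal_exp (hf : ContDiffAt ℝ ∞ f y) [FiniteDimensional ℝ E] (a : ℝ) :
    laplacianLocal G (fun x => Real.exp (a * f x)) y =
      Real.exp (a * f y) * (a * laplacianLocal G f y +
        a ^ 2 * fderiv ℝ f y (gradLocal G f y)) := by
  have h : ((G y).inverse.comp (hessianLocal G (fun x => Real.exp (a * f x)) y) :
      E →L[ℝ] E).toLinearMap = Real.exp (a * f y) • (a • (hessianEnd G f y).toLinearMap +
        a ^ 2 • (fderiv ℝ f y).toLinearMap.smulRight (gradLocal G f y)) := by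
    rw [hessianLocal_exp hf]
    refine LinearMap.ext fun u => ?_
    simp [hessianEnd, gradLocal]
  rw [laplacianLocal, h]
  simp only [map_add, map_smul, LinearMap.trace_smulRight, trace_hessianEnd, smul_eq_mul,
    ContinuousLinearMap.coe_coe]

end Power

/-! ### Locality of the Ricci tensor -/

section Germ

variable {E : Type*} [NormedAddCommGroup E] [NormedSpace ℝ E]
  {G G' : E → E →L[ℝ] E →L[ℝ] ℝ} {y : E}

theorem christoffel_congr (h : G =ᶠ[nhds y] G') : christoffel G =ᶠ[nhds y] christoffel G' := by
  filter_upwards [h.eventuallyEq_nhds] with z hz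
  unfold christoffel christoffelFirst
  rw [hz.eq_of_nhds, hz.fderiv_eq]

/-- Needed because the product metric has its warped coordinate form only on the chart target. -/
theorem ricciLocal_congr (h : G =ᶠ[nhds y] G') : ricciLocal G y = ricciLocal G' y := by
  have hc := christoffel_congr h
  have hR : riemannLocal G y = riemannLocal G' y := by
    unfold riemannLocal
    rw [hc.fderiv_eq, hc.eq_of_nhds]
  funext v w
  rw [← trace_riemannEnd, ← trace_riemannEnd]
  congr 1
  exact LinearMap.ext fun u => congrArg (fun R => R u v w) hR

end Germ

/-! ### From manifolds to charts -/

section Manifold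

variable {E : Type*} [NormedAddCommGroup E] [NormedSpace ℝ E]
  {H : Type*} [TopologicalSpace H] {I : ModelWithCorners ℝ E H}
  {M : Type*} [TopologicalSpace M] [ChartedSpace H M]

theorem Metric.ricci_zero (g : Metric I M) (p : M) : g.ricci p 0 0 = 0 := by
  have h : riemannEnd (inChart I g.val p) (extChartAt I p p) 0 0 = 0 :=
    LinearMap.ext fun u => by simp [riemannEnd, riemannLocal]
  exact (congrArg (LinearMap.trace ℝ E) h).trans (map_zero _)

variable [IsManifold I ∞ M]

theorem contDiffOn_comp_extChartAt_symm {φ : M → ℝ} (hφ : ContMDiff I 𝓘(ℝ, ℝ) ∞ φ) (p : M) :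
    ContDiffOn ℝ ∞ (φ ∘ (extChartAt I p).symm) (extChartAt I p).target :=
  contMDiffOn_iff_contDiffOn.1 (hφ.comp_contMDiffOn (contMDiffOn_extChartAt_symm p))

/-- The differential of the inverse chart is bijective on the target, so nondegeneracy passes to
coordinates. -/
theorem Metric.isMetricOn_inChart [I.Boundaryless] (g : Metric I M) (p : M) :
    IsMetricOn (inChart I g.val p) (extChartAt I p).target where
  isOpen := isOpen_extChartAt_target p
  contDiffOn := g.smooth p
  symm y _ u v := by
    rw [inChart_apply, inChart_apply]
    exact g.symm _ _ _
  nondegenerate y hy u h := by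
    have : IsManifold I 1 M := IsManifold.of_le (n := ∞) (by simp)
    have hinv := isInvertible_mfderivWithin_extChartAt_symm (I := I) (x := p) hy
    rw [I.range_eq_univ, mfderivWithin_univ] at hinv
    refine hinv.injective ((g.nondegenerate _ _ fun v => ?_).trans (map_zero _).symm)
    obtain ⟨w, rfl⟩ := hinv.surjective v
    exact h w

end Manifold

/-! ### The base conformal warped product and its Ricci tensor -/

section Product

variable {E₁ : Type*} [NormedAddCommGroup E₁] [NormedSpace ℝ E₁]
  {H₁ : Type*} [TopologicalSpace H₁] {I₁ : ModelWithCorners ℝ E₁ H₁} [I₁.Boundaryless]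
  {B : Type*} [TopologicalSpace B] [ChartedSpace H₁ B] [IsManifold I₁ ∞ B]
  {E₂ : Type*} [NormedAddCommGroup E₂] [NormedSpace ℝ E₂]
  {H₂ : Type*} [TopologicalSpace H₂] {I₂ : ModelWithCorners ℝ E₂ H₂} [I₂.Boundaryless]
  {F : Type*} [TopologicalSpace F] [ChartedSpace H₂ F] [IsManifold I₂ ∞ F]

theorem specialBcwp_val_apply (gB : Metric I₁ B) (gF : Metric I₂ F) (ψ : B → ℝ) (μ : ℝ)
    (hψ : ContMDiff I₁ 𝓘(ℝ, ℝ) ∞ ψ) (hψ0 : ∀ b, 0 < ψ b) (p : B × F)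
    (u v : TangentSpace (I₁.prod I₂) p) :
    (specialBcwp gB gF ψ μ hψ hψ0).val p u v =
      ψ p.1 ^ (2 * μ) * gB.val p.1 u.1 v.1 + ψ p.1 ^ 2 * gF.val p.2 u.2 v.2 := by
  have h := bcwpForm_apply gB gF (fun b => ψ b ^ μ) ψ p u v
  rw [mul_comm 2 μ, Real.rpow_mul (hψ0 p.1).le, Real.rpow_two]
  exact h

/-- Taking `f = log ψ` makes every real power of `ψ` an exponential `e^(af)`. -/
theorem inChart_specialBcwp (gB : Metric I₁ B) (gF : Metric I₂ F) (ψ : B → ℝ) (μ : ℝ)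
    (hψ : ContMDiff I₁ 𝓘(ℝ, ℝ) ∞ ψ) (hψ0 : ∀ b, 0 < ψ b) (p : B × F)
    {y : E₁ × E₂} (hy : y ∈ (extChartAt (I₁.prod I₂) p).target) :
    inChart (I₁.prod I₂) (specialBcwp gB gF ψ μ hψ hψ0).val p y =
      warpedLocal (inChart I₁ gB.val p.1) (inChart I₂ gF.val p.2)
        ((fun b => Real.log (ψ b)) ∘ (extChartAt I₁ p.1).symm) μ y := by
  refine (inChart_bcwpForm gB gF (fun b => ψ b ^ μ) ψ p y hy).trans ?_
  have h0 := hψ0 ((extChartAt I₁ p.1).symm y.1)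
  have e1 : (ψ ((extChartAt I₁ p.1).symm y.1) ^ μ) ^ 2 =
      Real.exp (2 * μ * Real.log (ψ ((extChartAt I₁ p.1).symm y.1))) := by
    rw [Real.rpow_def_of_pos h0, ← Real.exp_nat_mul]
    congr 1
    push_cast
    ring
  have e2 : ψ ((extChartAt I₁ p.1).symm y.1) ^ 2 =
      Real.exp (2 * Real.log (ψ ((extChartAt I₁ p.1).symm y.1))) := by
    rw [two_mul, Real.exp_add, Real.exp_log h0, sq]
  simp only [e1, e2]
  rfl

/-- The Ricci tensor of the `(ψ, μ)`-base conformal warped product. -/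
theorem ricci_specialBcwp [FiniteDimensional ℝ E₁] [FiniteDimensional ℝ E₂]
    (gB : Metric I₁ B) (gF : Metric I₂ F) (ψ : B → ℝ) {μ : ℝ}
    (hψ : ContMDiff I₁ 𝓘(ℝ, ℝ) ∞ ψ) (hψ0 : ∀ b, 0 < ψ b)
    {m k : ℕ} (hm : Module.finrank ℝ E₁ = m) (hk : Module.finrank ℝ E₂ = k)
    (hμ : μ ≠ 0) (hD : ((m : ℝ) - 2) * μ + k ≠ 0)
    (hN : μ * (((m : ℝ) - 2) * μ + k) + k * (μ - 1) ≠ 0)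
    (p : B × F) (u v : TangentSpace (I₁.prod I₂) p) :
    (specialBcwp gB gF ψ μ hψ hψ0).ricci p u v =
      (gB.ricci p.1 u.1 v.1
        + betaHess m k μ * (1 / ψ p.1 ^ (1 / alphaHess m k μ)) *
            gB.hessian (fun x => ψ x ^ (1 / alphaHess m k μ)) p.1 u.1 v.1
        - betaDelta m k μ * (1 / ψ p.1 ^ (1 / alphaDelta m k μ)) *
            gB.laplacian (fun x => ψ x ^ (1 / alphaDelta m k μ)) p.1 *
            gB.val p.1 u.1 v.1) +
      (gF.ricci p.2 u.2 v.2
        - 1 / ψ p.1 ^ (2 * (μ - 1)) * (betaDelta m k μ / μ) *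
            (1 / ψ p.1 ^ (1 / alphaDelta m k μ)) *
            gB.laplacian (fun x => ψ x ^ (1 / alphaDelta m k μ)) p.1 *
            gF.val p.2 u.2 v.2) := by
  set f : E₁ → ℝ := (fun b => Real.log (ψ b)) ∘ (extChartAt I₁ p.1).symm with hf_def
  have hlog : ContMDiff I₁ 𝓘(ℝ, ℝ) ∞ (fun b => Real.log (ψ b)) := fun b =>
    (Real.contDiffAt_log.2 (hψ0 b).ne').contMDiffAt.comp b (hψ b)
  have hf : ContDiffOn ℝ ∞ f (extChartAt I₁ p.1).target :=
    contDiffOn_comp_extChartAt_symm hlog p.1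
  set y : E₁ × E₂ := extChartAt (I₁.prod I₂) p p with hy_def
  have hy : y ∈ (extChartAt (I₁.prod I₂) p).target := mem_extChartAt_target p
  have hy1 : y.1 = extChartAt I₁ p.1 p.1 := by rw [hy_def, extChartAt_prod]; rfl
  have hy2 : y.2 = extChartAt I₂ p.2 p.2 := by rw [hy_def, extChartAt_prod]; rfl
  have hy' : y ∈ (extChartAt I₁ p.1).target ×ˢ (extChartAt I₂ p.2).target := by
    rw [extChartAt_prod] at hy
    exact hy
  have hfy : ContDiffAt ℝ ∞ f y.1 :=
    hf.contDiffAt ((isOpen_extChartAt_target p.1).mem_nhds hy'.1)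
  have hfval : f y.1 = Real.log (ψ p.1) := by
    rw [hf_def, hy1]
    simp
  have hpow : ∀ a : ℝ, ψ p.1 ^ a = Real.exp (a * f y.1) := fun a => by
    rw [hfval, Real.rpow_def_of_pos (hψ0 _), mul_comm]
  have hpow' : ∀ a : ℝ, (fun x => ψ x ^ a) ∘ (extChartAt I₁ p.1).symm =
      fun x => Real.exp (a * f x) := fun a => by
    funext x
    simp only [hf_def, Function.comp_apply]
    rw [Real.rpow_def_of_pos (hψ0 _), mul_comm]
  have hric : (specialBcwp gB gF ψ μ hψ hψ0).ricci p u v =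
      ricciLocal (warpedLocal (inChart I₁ gB.val p.1) (inChart I₂ gF.val p.2) f μ) y u v := by
    have h := ricciLocal_congr (Filter.eventually_of_mem
      ((isOpen_extChartAt_target (I := I₁.prod I₂) p).mem_nhds hy)
      fun z hz => inChart_specialBcwp gB gF ψ μ hψ hψ0 p hz)
    exact congrFun (congrFun h u) v
  have hhess : ∀ a : ℝ, gB.hessian (fun x => ψ x ^ a) p.1 u.1 v.1 =
      Real.exp (a * f y.1) * (a * hessianLocal (inChart I₁ gB.val p.1) f y.1 u.1 v.1 +
        a ^ 2 * (fderiv ℝ f y.1 u.1 * fderiv ℝ f y.1 v.1)) := fun a => by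
    unfold Metric.hessian
    rw [hpow', ← hy1, hessianLocal_exp hfy]
    rfl
  have hlap : ∀ a : ℝ, gB.laplacian (fun x => ψ x ^ a) p.1 =
      Real.exp (a * f y.1) * (a * laplacianLocal (inChart I₁ gB.val p.1) f y.1 +
        a ^ 2 * fderiv ℝ f y.1 (gradLocal (inChart I₁ gB.val p.1) f y.1)) := fun a => by
    rw [Metric.laplacian, hpow', ← hy1, laplacianLocal_exp hfy]
  have hB : inChart I₁ gB.val p.1 y.1 u.1 v.1 = gB.val p.1 u.1 v.1 := by
    rw [hy1]
    exact inChart_self I₁ gB.val p.1 u.1 v.1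
  have hF : inChart I₂ gF.val p.2 y.2 u.2 v.2 = gF.val p.2 u.2 v.2 := by
    rw [hy2]
    exact inChart_self I₂ gF.val p.2 u.2 v.2
  have hrB : ricciLocal (inChart I₁ gB.val p.1) y.1 u.1 v.1 = gB.ricci p.1 u.1 v.1 := by
    rw [hy1]
    rfl
  have hrF : ricciLocal (inChart I₂ gF.val p.2) y.2 u.2 v.2 = gF.ricci p.2 u.2 v.2 := by
    rw [hy2]
    rfl
  have hE : Real.exp ((2 - 2 * μ) * f y.1) = (Real.exp (2 * (μ - 1) * f y.1))⁻¹ := by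
    rw [← Real.exp_neg]
    congr 1
    ring
  have hmain := ricciLocal_warpedLocal (gB.isMetricOn_inChart p.1) (gF.isMetricOn_inChart p.2)
    hf μ hy' u v (congrArg Nat.cast hm) (congrArg Nat.cast hk)
  rw [hric, hmain, hhess, hlap, hpow, hpow, hpow, hE, hB, hF, hrB, hrF]
  have hx1 := Real.exp_ne_zero (1 / alphaHess m k μ * f y.1)
  have hx2 := Real.exp_ne_zero (1 / alphaDelta m k μ * f y.1)
  have hx3 := Real.exp_ne_zero (2 * (μ - 1) * f y.1)
  -- With `a = -N/D` and `β^H = D²/N`, one gets `β^H a = -D` and `β^H a² = N`; with `a = D` and `β^Δ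
  -- = μ/D`, one gets `β^Δ a = μ` and `β^Δ a² = μ D`. These are the coefficients in `hmain`.
  have ea : 1 / alphaHess m k μ = -(μ * (((m : ℝ) - 2) * μ + k) + k * (μ - 1)) /
      (((m : ℝ) - 2) * μ + k) := by
    rw [alphaHess, one_div_div, div_neg, neg_div]
  have ed : 1 / alphaDelta m k μ = ((m : ℝ) - 2) * μ + k := by
    rw [alphaDelta, one_div_one_div]
  generalize Real.exp (1 / alphaHess m k μ * f y.1) = x1 at *
  generalize Real.exp (1 / alphaDelta m k μ * f y.1) = x2 at *
  rw [ea, ed, betaHess, betaDelta]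
  generalize Real.exp (2 * (μ - 1) * f y.1) = x3 at *
  generalize hNv : μ * (((m : ℝ) - 2) * μ + k) + k * (μ - 1) = N at *
  generalize hDv : ((m : ℝ) - 2) * μ + k = D at *
  field_simp
  ring

end Product

/-! ### The exceptional values of `μ` -/

theorem coeff_ne_zero {m k : ℕ} (hm : 3 ≤ m) {μ : ℝ} (hμbar : μ ≠ muBar m k) :
    ((m : ℝ) - 2) * μ + k ≠ 0 := by
  have hm2 : (0 : ℝ) < m - 2 := by
    have : (3 : ℝ) ≤ m := by exact_mod_cast hm
    linarith
  intro h
  apply hμbar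
  rw [muBar, eq_div_iff hm2.ne']
  linarith

/-- Substituting `k = -(m - 2) μ̄` gives `(m - 2) (μ² - 2 μ̄ μ + μ̄)`, whose roots are `μ̄ ± √(μ̄² -
μ̄)`; they are real because `μ̄ ≤ 0`. -/
theorem coeff_hess_ne_zero {m k : ℕ} (hm : 3 ≤ m) {μ : ℝ}
    (hplus : μ ≠ muBar m k + Real.sqrt (muBar m k ^ 2 - muBar m k))
    (hminus : μ ≠ muBar m k - Real.sqrt (muBar m k ^ 2 - muBar m k)) :
    μ * (((m : ℝ) - 2) * μ + k) + k * (μ - 1) ≠ 0 := by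
  have hm2 : (0 : ℝ) < m - 2 := by
    have : (3 : ℝ) ≤ m := by exact_mod_cast hm
    linarith
  have hk : (k : ℝ) = -((m - 2) * muBar m k) := by
    rw [muBar]
    field_simp
  have hbar : muBar m k ≤ 0 := div_nonpos_of_nonpos_of_nonneg (by simp) hm2.le
  have hs := Real.sq_sqrt (show 0 ≤ muBar m k ^ 2 - muBar m k by nlinarith)
  set s := Real.sqrt (muBar m k ^ 2 - muBar m k)
  have hfac : μ * (((m : ℝ) - 2) * μ + k) + k * (μ - 1) =
      (m - 2) * ((μ - (muBar m k + s)) * (μ - (muBar m k - s))) := by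
    rw [hk]
    linear_combination ((m : ℝ) - 2) * hs
  rw [hfac]
  exact mul_ne_zero hm2.ne' (mul_ne_zero (sub_ne_zero.2 hplus) (sub_ne_zero.2 hminus))

theorem Metric.exists_val_ne_zero {E : Type*} [NormedAddCommGroup E] [NormedSpace ℝ E]
    [Nontrivial E] {H : Type*} [TopologicalSpace H] {I : ModelWithCorners ℝ E H}
    {M : Type*} [TopologicalSpace M] [ChartedSpace H M] (g : Metric I M) (p : M) :
    ∃ v w : TangentSpace I p, g.val p v w ≠ 0 := by
  obtain ⟨v, hv⟩ := exists_ne (0 : E)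
  by_contra! h
  exact hv (g.nondegenerate p v (h v))

end PseudoRiem

/-! ### Splitting the Einstein equation -/

theorem mainTheorem12
    {EB : Type*} [NormedAddCommGroup EB] [NormedSpace ℝ EB] [FiniteDimensional ℝ EB]
    {HB : Type*} [TopologicalSpace HB] (IB : ModelWithCorners ℝ EB HB) [IB.Boundaryless]
    {B : Type*} [TopologicalSpace B] [ChartedSpace HB B] [IsManifold IB ∞ B] [ConnectedSpace B]
    {EF : Type*} [NormedAddCommGroup EF] [NormedSpace ℝ EF] [FiniteDimensional ℝ EF]
    {HF : Type*} [TopologicalSpace HF] (IF : ModelWithCorners ℝ EF HF) [IF.Boundaryless]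
    {F : Type*} [TopologicalSpace F] [ChartedSpace HF F] [IsManifold IF ∞ F] [ConnectedSpace F]
    (m k : ℕ) (hm : Module.finrank ℝ EB = m) (hk : Module.finrank ℝ EF = k)
    (hm3 : 3 ≤ m) (hk1 : 1 ≤ k)
    (gB : PseudoRiem.Metric IB B) (gF : PseudoRiem.Metric IF F)
    (μ : ℝ) (hμ0 : μ ≠ 0) (hμ1 : μ ≠ 1) (hμbar : μ ≠ PseudoRiem.muBar m k)
    (hμplus : μ ≠ PseudoRiem.muBar m k +
      Real.sqrt (PseudoRiem.muBar m k ^ 2 - PseudoRiem.muBar m k))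
    (hμminus : μ ≠ PseudoRiem.muBar m k -
      Real.sqrt (PseudoRiem.muBar m k ^ 2 - PseudoRiem.muBar m k))
    (ψ : B → ℝ) (hψ : ContMDiff IB 𝓘(ℝ, ℝ) ∞ ψ) (hψ0 : ∀ b, 0 < ψ b)
    (lam : ℝ) :
    (PseudoRiem.specialBcwp gB gF ψ μ hψ hψ0).IsEinstein lam ↔
      ∃ ν : ℝ, gF.IsEinstein ν ∧
        (∀ (b : B) (X Y : TangentSpace IB b),
          lam * ψ b ^ (2 * μ) * gB.val b X Y =
            gB.ricci b X Y
            + PseudoRiem.betaHess m k μ * (1 / ψ b ^ (1 / PseudoRiem.alphaHess m k μ)) *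
                gB.hessian (fun x => ψ x ^ (1 / PseudoRiem.alphaHess m k μ)) b X Y
            - PseudoRiem.betaDelta m k μ * (1 / ψ b ^ (1 / PseudoRiem.alphaDelta m k μ)) *
                gB.laplacian (fun x => ψ x ^ (1 / PseudoRiem.alphaDelta m k μ)) b *
                gB.val b X Y) ∧
        (∀ b : B,
          lam * ψ b ^ 2 =
            ν - 1 / ψ b ^ (2 * (μ - 1)) * (PseudoRiem.betaDelta m k μ / μ) *
              (1 / ψ b ^ (1 / PseudoRiem.alphaDelta m k μ)) *
              gB.laplacian (fun x => ψ x ^ (1 / PseudoRiem.alphaDelta m k μ)) b) := by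
  have hD := PseudoRiem.coeff_ne_zero hm3 hμbar
  have hN := PseudoRiem.coeff_hess_ne_zero hm3 hμplus hμminus
  have hric := PseudoRiem.ricci_specialBcwp gB gF ψ hψ hψ0 hm hk hμ0 hD hN
  have hval := PseudoRiem.specialBcwp_val_apply gB gF ψ μ hψ hψ0
  have hEF : Nontrivial EF := Module.nontrivial_of_finrank_pos (R := ℝ) (by omega)
  constructor
  · intro hE
    have key := fun (b : B) (x : F) (X Y : TangentSpace IB b) (V W : TangentSpace IF x) =>
      (hric (b, x) (X, V) (Y, W)).symm.trans
        ((hE (b, x) (X, V) (Y, W)).trans (congrArg (lam * ·) (hval (b, x) (X, V) (Y, W))))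
    dsimp only at key
    obtain ⟨b₀⟩ : Nonempty B := inferInstance
    obtain ⟨x₀⟩ : Nonempty F := inferInstance
    have hbase := fun (b : B) (X Y : TangentSpace IB b) => key b x₀ X Y 0 0
    simp only [gF.ricci_zero, map_zero, mul_zero, sub_zero, add_zero] at hbase
    have hfib := fun (b : B) (x : F) (V W : TangentSpace IF x) => key b x 0 0 V W
    have hbase₀ := fun b : B => hbase b 0 0
    simp only [map_zero, mul_zero, zero_add] at hfib hbase₀
    -- The base Ricci and Hessian terms at zero vectors need no evaluation: subtracting `hbase₀`
    -- cancels them.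
    have hfib' : ∀ (b : B) (x : F) (V W : TangentSpace IF x), gF.ricci x V W =
        (lam * ψ b ^ 2 + 1 / ψ b ^ (2 * (μ - 1)) * (PseudoRiem.betaDelta m k μ / μ) *
              (1 / ψ b ^ (1 / PseudoRiem.alphaDelta m k μ)) *
              gB.laplacian (fun x => ψ x ^ (1 / PseudoRiem.alphaDelta m k μ)) b) *
          gF.val x V W := fun b x V W => by
      linear_combination hfib b x V W - hbase₀ b
    -- The constant `ν` is the factor of `g_F` in `hfib'` at the chosen point `b₀`.
    refine ⟨_, hfib' b₀, fun b X Y => ?_, fun b => ?_⟩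
    · rw [hbase b X Y, mul_assoc]
    -- The left side of `hfib'` does not involve `b`; cancelling a nonzero value of `g_F`, available
    -- since `k ≥ 1`, shows that the factors at `b` and `b₀` agree.
    · obtain ⟨V, W, hVW⟩ := gF.exists_val_ne_zero x₀
      have h := mul_right_cancel₀ hVW ((hfib' b₀ x₀ V W).symm.trans (hfib' b x₀ V W))
      rw [h]
      ring
  · rintro ⟨ν, hν, hbase, hfib⟩ p u v
    rw [hric, hval]
    linear_combination
      hν p.2 u.2 v.2 - hbase p.1 u.1 v.1 - gF.val p.2 u.2 v.2 * hfib p.1
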